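/- Let $R$ be an integral domain, $n=2^m$, and let $i\ge 0$ be an integer with $i\le \log_2 n-3$. Put $N=n/2^{i+1}$ and $K=\frac{(2^{i+1}-1)n}{2^{i+1}}$. For a matrix $M$ of size $2^k$ with $k\ge 1$, with four equal quadrants $M_{11},M_{12},M_{21},M_{22}$, put $$\Delta(M)=\operatorname{Det}(M_{11})\,M_{22}-M_{21}\operatorname{Adj}(M_{11})\,M_{12}.$$ A content of a matrix is a greatest common divisor of all its entries (determined up to units): an element that divides every entry and is divisible by every common divisor of the entries. Let $A=(a_{s,t})$ be the symbolic $n\times n$ matrix, whose entries are $n^2$ distinct indeterminates over $R$. Let $\Delta_0$ be $\Delta(A)$ divided by its content and, for $j\ge 0$, let $\Delta_{j+1}$ be $\Delta(\Delta_j)$ divided by its content; so $\Delta_j$ has size $n/2^{j+1}$ and is determined up to a unit. Let $\Delta_i^{adj}=\operatorname{Adj}(\Delta_i)$, and write $A_{1..K,1..K}$ for the upper left $K\times K$ submatrix of $A$. Then $\Delta_i$ exists (that is, all the contents involved exist), and for every choice of $\Delta_i$ the matrix $\Delta_i^{adj}$ has content $$\operatorname{Det}(A_{1..K,1..K})^{N-2}.$$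 Let $Q$ be the matrix with $\Delta_i^{adj}=\operatorname{Det}(A_{1..K,1..K})^{N-2}\,Q$. Its degree is as follows. 1. Every entry of $Q$ is a polynomial of total degree exactly $n-1$ in the symbols $a_{s,t}$. 2. Let $S$ be a commutative $R$-algebra, and substitute for the $a_{s,t}$ the entries of any $n\times n$ matrix over $S[x_1,\dots,x_r]$ whose entries have total degree at most $d$. Then the identity $\Delta_i^{adj}=\operatorname{Det}(A_{1..K,1..K})^{N-2}\,Q$ continues to hold after the substitution, and every entry of the substituted $Q$ has total degree at most $(n-1)d$. 3. If $r\ge 1$ and the substituted entries are general polynomials of degree $d$ in $x_1,\dots,x_r$ (all coefficients of the monomials of degree at most $d$, in all the entries, are distinct indeterminates over $R$), then every entry of the substituted $Q$ has total degree exactly $(n-1)d$ in $x_1,\dots,x_r$. -/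

import Mathlib

/-!
By Sylvester's determinant identity, the fraction-free Schur complement of a leading `K × K` block
is the matrix of the minors bordering that block, and the fraction-free Schur complement of such a
matrix is again one, times a power of a leading minor. For `a ≠ b`, the minors bordering the block
by row and column `a` and by row and column `b` have no common factor: give weight `1` to the
variables of the diagonal term of the second minor and of one full cycle of the first one, and
weight `0` to all others. Refined by any monomial order, this weight selects these two terms as
leading terms; their monomials are disjoint and their coefficients are units, so the two minors
form a regular sequence. Hence the content cancelled at each step is exactly the power of the
leading minor, up to a unit. The adjugate of the last matrix is a power of the leading minor times
a block of the adjugate of `A`, whose entries are homogeneous of degree `n - 1`; its last two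
diagonal entries are bordered minors of the block of size `n - 2`, so this factorization too
exhibits the content. Specializing the general polynomials to pure powers of one variable shows
that their degree `d` is multiplied by exactly `n - 1`.
-/

/-- `c` is a content (a greatest common divisor of all the entries) of the matrix `C`: it divides
every entry, and every common divisor of the entries divides it. A content is determined up to
units. -/
def IsContent {S ι κ : Type*} [CommRing S] (c : S) (C : Matrix ι κ S) : Prop :=
  (∀ a b, c ∣ C a b) ∧ ∀ f : S, (∀ a b, f ∣ C a b) → f ∣ c

/-- `D` is the result of dividing `C` elementwise by a content of `C`. -/
def IsCancelled {S ι κ : Type*} [CommRing S] (C D : Matrix ι κ S) : Prop :=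
  ∃ c : S, IsContent c C ∧ C = c • D

/-- Indices of the first half of the rows or columns of a matrix of size `2 ^ (k + 1)`. -/
def firstHalf (k : ℕ) (s : Fin (2 ^ k)) : Fin (2 ^ (k + 1)) :=
  ⟨s, by have := s.2; rw [pow_succ]; omega⟩

/-- Indices of the second half of the rows or columns of a matrix of size `2 ^ (k + 1)`. -/
def secondHalf (k : ℕ) (s : Fin (2 ^ k)) : Fin (2 ^ (k + 1)) :=
  ⟨2 ^ k + s, by have := s.2; rw [pow_succ]; omega⟩

/-- The fraction-free Schur complement `Det(A₁₁) A₂₂ - A₂₁ Adj(A₁₁) A₁₂`, where the `Aᵢⱼ` are the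
four equal quadrants of `A`. -/
def fractionFreeDelta {S : Type*} [CommRing S] {k : ℕ}
    (A : Matrix (Fin (2 ^ (k + 1))) (Fin (2 ^ (k + 1))) S) : Matrix (Fin (2 ^ k)) (Fin (2 ^ k)) S :=
  (A.submatrix (firstHalf k) (firstHalf k)).det • A.submatrix (secondHalf k) (secondHalf k) -
    A.submatrix (secondHalf k) (firstHalf k) *
      (A.submatrix (firstHalf k) (firstHalf k)).adjugate *
      A.submatrix (firstHalf k) (secondHalf k)

/-- `IsReducedDelta i A D`: the matrix `D` is the `i`-th `Δ` of `A` after cancellation of its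
content. The `0`-th is the cancelled `Δ` of `A`; the `(i+1)`-st is the cancelled `Δ` of the `i`-th
(already cancelled) one. -/
inductive IsReducedDelta {S : Type*} [CommRing S] :
    {m k : ℕ} → ℕ → Matrix (Fin (2 ^ m)) (Fin (2 ^ m)) S → Matrix (Fin (2 ^ k)) (Fin (2 ^ k)) S → Prop
  | zero {k : ℕ} (A : Matrix (Fin (2 ^ (k + 1))) (Fin (2 ^ (k + 1))) S)
      (D : Matrix (Fin (2 ^ k)) (Fin (2 ^ k)) S)
      (hD : IsCancelled (fractionFreeDelta A) D) :
      IsReducedDelta 0 A D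
  | succ {m k i : ℕ} (A : Matrix (Fin (2 ^ m)) (Fin (2 ^ m)) S)
      (B : Matrix (Fin (2 ^ (k + 1))) (Fin (2 ^ (k + 1))) S)
      (D : Matrix (Fin (2 ^ k)) (Fin (2 ^ k)) S)
      (hB : IsReducedDelta i A B) (hD : IsCancelled (fractionFreeDelta B) D) :
      IsReducedDelta (i + 1) A D

/-- The determinant of the upper left `r × r` submatrix of an `n × n` matrix, for `r ≤ n`
(equal to `1` for `r = 0`). -/
def leadingMinor {S : Type*} [CommRing S] {n : ℕ} (A : Matrix (Fin n) (Fin n) S) (r : ℕ) : S :=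
  (A.submatrix (fun s : {s : Fin n // s.val < r} => s.val)
    (fun s : {s : Fin n // s.val < r} => s.val)).det

/-- The `n × n` matrix whose entries are the general polynomials of degree `d` in `r` variables:
the coefficients of all the monomials of degree at most `d`, in all the entries, are distinct
indeterminates. -/
noncomputable def genericPolynomialMatrix (R : Type*) [CommRing R] (n r d : ℕ) :
    Matrix (Fin n) (Fin n)
      (MvPolynomial (Fin r) (MvPolynomial (Fin n × Fin n × (Fin r →₀ ℕ)) R)) :=
  Matrix.of fun s t =>
    ∑ e ∈ Finset.range (d + 1), ∑ α ∈ Finset.finsuppAntidiag Finset.univ e,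
      MvPolynomial.monomial α (MvPolynomial.X (s, t, α))

section BorderedMinors

open Matrix Polynomial

theorem submatrix_sumElim {S κ ν κ' ν' μ μ' : Type*} (A : Matrix μ μ' S) (p : κ → μ) (f : ν → μ)
    (q : κ' → μ') (g : ν' → μ') :
    A.submatrix (Sum.elim p f) (Sum.elim q g) =
      fromBlocks (A.submatrix p q) (A.submatrix p g) (A.submatrix f q) (A.submatrix f g) := by
  ext (_ | _) (_ | _) <;> rfl

variable {S κ ν : Type*} [CommRing S] [Fintype κ] [DecidableEq κ]

section FractionFreeSchurComplement

variable [Fintype ν] [DecidableEq ν] (P : Matrix κ κ S) (Q : Matrix κ ν S) (R : Matrix ν κ S)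
  (T : Matrix ν ν S)

theorem fromBlocks_mul_fromBlocks_adjugate :
    fromBlocks P Q R T * fromBlocks P.adjugate (-(P.adjugate * Q)) 0 (P.det • 1) =
      fromBlocks (P.det • 1) 0 (R * P.adjugate) (P.det • T - R * P.adjugate * Q) := by
  simp only [fromBlocks_multiply, mul_adjugate, Matrix.mul_neg, ← Matrix.mul_assoc, Matrix.mul_zero,
    add_zero, Matrix.smul_mul, Matrix.one_mul, Matrix.mul_smul, Matrix.mul_one, neg_add_cancel,
    neg_add_eq_sub]

theorem det_fractionFree_schurComplement_of_isRegular [Nonempty ν] {P : Matrix κ κ S}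
    (hP : IsRegular P.det) :
    (P.det • T - R * P.adjugate * Q).det =
      P.det ^ (Fintype.card ν - 1) * (fromBlocks P Q R T).det := by
  have hdet := congrArg det (fromBlocks_mul_fromBlocks_adjugate P Q R T)
  rw [det_mul, det_fromBlocks_zero₂₁, det_fromBlocks_zero₁₂, det_smul, det_one, det_smul,
    det_one, mul_one, mul_one] at hdet
  have hadj : P.adjugate.det * P.det = P.det ^ Fintype.card κ := by
    rw [← det_mul, adjugate_mul, det_smul, det_one, mul_one]
  have hcard : P.det ^ Fintype.card ν = P.det ^ (Fintype.card ν - 1) * P.det := by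
    rw [← pow_succ, Nat.sub_add_cancel Fintype.card_pos]
  apply (hP.pow (Fintype.card κ + 1)).left
  calc P.det ^ (Fintype.card κ + 1) * (P.det • T - R * P.adjugate * Q).det
      = P.det * (P.det ^ Fintype.card κ * (P.det • T - R * P.adjugate * Q).det) := by ring
    _ = (P.adjugate.det * P.det) * (P.det ^ Fintype.card ν * (fromBlocks P Q R T).det) := by
        rw [← hdet]; ring
    _ = P.det ^ (Fintype.card κ + 1) *
          (P.det ^ (Fintype.card ν - 1) * (fromBlocks P Q R T).det) := by
        rw [hadj, hcard]; ring

theorem det_fractionFree_schurComplement [Nonempty ν] :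
    (P.det • T - R * P.adjugate * Q).det =
      P.det ^ (Fintype.card ν - 1) * (fromBlocks P Q R T).det := by
  -- Adding an indeterminate to the diagonal of `P` makes its determinant monic, hence regular.
  let P' : Matrix κ κ S[X] := (X : S[X]) • 1 + P.map C
  let φ : S[X] →+* S := evalRingHom 0
  have hP' : P'.det.Monic := leadingCoeff_det_X_one_add_C P
  have hP : P'.map φ = P := by
    ext
    simp [P', φ]
  have hC : (φ : S[X] → S) ∘ (C : S → S[X]) = id := by
    ext
    simp [φ]
  have hdet : φ P'.det = P.det := by rw [φ.map_det, RingHom.mapMatrix_apply, hP]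
  have hadj : P'.adjugate.map φ = P.adjugate := by
    rw [← RingHom.mapMatrix_apply, φ.map_adjugate, RingHom.mapMatrix_apply, hP]
  have h := congrArg φ (det_fractionFree_schurComplement_of_isRegular (Q.map C) (R.map C) (T.map C)
    hP'.isRegular)
  simpa only [φ.map_det, map_mul, map_pow, RingHom.mapMatrix_apply, hdet, hadj, hP, fromBlocks_map,
    Matrix.map_sub φ (map_sub φ), Matrix.map_smulₛₗ φ φ _ (map_mul φ _), Matrix.map_mul, map_map,
    hC, map_id] using h

end FractionFreeSchurComplement

variable {μ μ' : Type*} (A : Matrix μ μ' S)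

/-- The matrix of the minors of `A` obtained by bordering the rows `p` and the columns `q` by one
more row and one more column; these are the entries in Sylvester's determinant identity. -/
def borderedMinors (p : κ → μ) (q : κ → μ') : Matrix μ μ' S :=
  of fun a b => (A.submatrix (Sum.elim p fun _ : Unit => a) (Sum.elim q fun _ : Unit => b)).det

theorem borderedMinors_submatrix (p : κ → μ) (q : κ → μ') {ν' : Type*} (f : ν → μ) (g : ν' → μ') :
    (borderedMinors A p q).submatrix f g = (A.submatrix p q).det • A.submatrix f g -
      A.submatrix f q * (A.submatrix p q).adjugate * A.submatrix p g := by
  ext a b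
  have h := det_fractionFree_schurComplement (A.submatrix p q) (A.submatrix p fun _ : Unit => g b)
    (A.submatrix (fun _ : Unit => f a) q) (A.submatrix (fun _ : Unit => f a) fun _ : Unit => g b)
  rw [det_unique, Fintype.card_unit, Nat.sub_self, pow_zero, one_mul, ← submatrix_sumElim] at h
  exact h.symm

/-- Sylvester's determinant identity. -/
theorem det_borderedMinors_submatrix [Fintype ν] [DecidableEq ν] [Nonempty ν] (p : κ → μ)
    (q : κ → μ') (f : ν → μ) (g : ν → μ') :
    ((borderedMinors A p q).submatrix f g).det =
      (A.submatrix p q).det ^ (Fintype.card ν - 1) *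
        (A.submatrix (Sum.elim p f) (Sum.elim q g)).det := by
  rw [borderedMinors_submatrix, det_fractionFree_schurComplement, ← submatrix_sumElim]

theorem borderedMinors_borderedMinors [Fintype ν] [DecidableEq ν] (p : κ → μ) (q : κ → μ')
    (f : ν → μ) (g : ν → μ') :
    borderedMinors (borderedMinors A p q) f g =
      (A.submatrix p q).det ^ Fintype.card ν • borderedMinors A (Sum.elim p f) (Sum.elim q g) := by
  ext a b
  rw [borderedMinors, of_apply, det_borderedMinors_submatrix, Fintype.card_sum, Fintype.card_unit,
    Nat.add_sub_cancel, Matrix.smul_apply, smul_eq_mul, borderedMinors, of_apply,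
    ← det_submatrix_equiv_self (Equiv.sumAssoc κ ν Unit).symm
      (A.submatrix (Sum.elim (Sum.elim p f) fun _ => a) (Sum.elim (Sum.elim q g) fun _ => b)),
    submatrix_submatrix]
  congr 3 <;> ext (_ | _ | _) <;> rfl

theorem borderedMinors_comp_equiv {κ' : Type*} [Fintype κ'] [DecidableEq κ'] (e : κ' ≃ κ)
    (p : κ → μ) (q : κ → μ') : borderedMinors A (p ∘ e) (q ∘ e) = borderedMinors A p q := by
  ext a b
  rw [borderedMinors, borderedMinors, of_apply, of_apply,
    ← det_submatrix_equiv_self (e.sumCongr (Equiv.refl Unit))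
      (A.submatrix (Sum.elim p fun _ => a) (Sum.elim q fun _ => b)), submatrix_submatrix]
  congr 2 <;> ext (_ | _) <;> rfl

theorem borderedMinors_smul (c : S) (p : κ → μ) (q : κ → μ') :
    borderedMinors (c • A) p q = c ^ (Fintype.card κ + 1) • borderedMinors A p q := by
  ext a b
  simp [borderedMinors, submatrix_smul]

theorem borderedMinors_of_submatrix {α β : Type*} (f : α → μ) (g : β → μ') (p : κ → α)
    (q : κ → β) :
    borderedMinors (A.submatrix f g) p q = (borderedMinors A (f ∘ p) (g ∘ q)).submatrix f g := by
  ext a b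
  simp only [borderedMinors, of_apply, submatrix_apply, submatrix_submatrix, Sum.comp_elim]
  rfl

end BorderedMinors

section LeadingBlock

open Matrix

variable {S : Type*} [CommRing S] {K N n : ℕ}

/-- The first `K` of `n = K + N` indices. -/
def headIndex (h : K + N = n) : Fin K → Fin n := Fin.cast h ∘ Fin.castAdd N

/-- The last `N` of `n = K + N` indices. -/
def tailIndex (h : K + N = n) : Fin N → Fin n := Fin.cast h ∘ Fin.natAdd K

theorem headIndex_comp_finSumFinEquiv {L N' : ℕ} (h : K + N = n) (hL : L + N' = N)
    (h' : K + L + N' = n) :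
    headIndex h' ∘ finSumFinEquiv = Sum.elim (headIndex h) (tailIndex h ∘ headIndex hL) := by
  ext (s | s) <;> rfl

theorem tailIndex_comp_tailIndex {L N' : ℕ} (h : K + N = n) (hL : L + N' = N)
    (h' : K + L + N' = n) : tailIndex h ∘ tailIndex hL = tailIndex h' := by
  ext s
  exact (add_assoc K L s).symm

theorem succAbove_tailIndex_comp_finSumFinEquiv (h : K + (N + 1) = n + 1) (h' : K + N = n)
    (a : Fin (N + 1)) :
    (tailIndex h a).succAbove ∘ Fin.cast h' ∘ finSumFinEquiv =
      Sum.elim (headIndex h) (tailIndex h ∘ a.succAbove) := by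
  ext (s | s)
  · have hs : (s : ℕ) < K + a := by omega
    simp [headIndex, tailIndex, Fin.succAbove, Fin.lt_def, hs]
  · simp only [tailIndex, Fin.succAbove, Fin.lt_def, Function.comp_apply, Sum.elim_inr,
      finSumFinEquiv_apply_right, Fin.val_cast, Fin.val_natAdd, Fin.val_castSucc,
      Nat.add_lt_add_iff_left]
    split_ifs <;> simp [add_assoc]

/-- The fraction-free Schur complement of the leading `K × K` block of a matrix of size
`n = K + N`: its entries are the minors obtained by bordering that block by one of the last `N`
rows and one of the last `N` columns. -/
def fractionFreeSchur (h : K + N = n) (A : Matrix (Fin n) (Fin n) S) : Matrix (Fin N) (Fin N) S :=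
  (borderedMinors A (headIndex h) (headIndex h)).submatrix (tailIndex h) (tailIndex h)

theorem leadingMinor_eq_det (h : K + N = n) (A : Matrix (Fin n) (Fin n) S) :
    leadingMinor A K = (A.submatrix (headIndex h) (headIndex h)).det :=
  (det_submatrix_equiv_self (Fin.castLEquiv (Nat.le.intro h)) _).symm

theorem map_leadingMinor {T : Type*} [CommRing T] (φ : S →+* T) (A : Matrix (Fin n) (Fin n) S)
    (K : ℕ) : φ (leadingMinor A K) = leadingMinor (A.map φ) K :=
  φ.map_det _

theorem fractionFreeDelta_eq_fractionFreeSchur {k : ℕ} (h : 2 ^ k + 2 ^ k = 2 ^ (k + 1))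
    (A : Matrix (Fin (2 ^ (k + 1))) (Fin (2 ^ (k + 1))) S) :
    fractionFreeDelta A = fractionFreeSchur h A :=
  (borderedMinors_submatrix A (headIndex h) (headIndex h) (tailIndex h) (tailIndex h)).symm

theorem fractionFreeSchur_smul (h : K + N = n) (c : S) (A : Matrix (Fin n) (Fin n) S) :
    fractionFreeSchur h (c • A) = c ^ (K + 1) • fractionFreeSchur h A := by
  rw [fractionFreeSchur, borderedMinors_smul, Fintype.card_fin]
  rfl

theorem fractionFreeSchur_fractionFreeSchur {L N' : ℕ} (h : K + N = n) (hL : L + N' = N)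
    (h' : K + L + N' = n) (A : Matrix (Fin n) (Fin n) S) :
    fractionFreeSchur hL (fractionFreeSchur h A) =
      leadingMinor A K ^ L • fractionFreeSchur h' A := by
  rw [fractionFreeSchur, fractionFreeSchur, borderedMinors_of_submatrix,
    borderedMinors_borderedMinors, ← headIndex_comp_finSumFinEquiv h hL h',
    borderedMinors_comp_equiv, submatrix_submatrix, tailIndex_comp_tailIndex h hL h',
    Fintype.card_fin, ← leadingMinor_eq_det]
  rfl

theorem adjugate_fractionFreeSchur (h : K + N = n) (hN : 2 ≤ N) (A : Matrix (Fin n) (Fin n) S) :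
    (fractionFreeSchur h A).adjugate =
      leadingMinor A K ^ (N - 2) • A.adjugate.submatrix (tailIndex h) (tailIndex h) := by
  obtain ⟨N, rfl⟩ := Nat.exists_eq_add_of_le' hN
  obtain ⟨n, rfl⟩ : ∃ n', n = n' + 1 := ⟨K + (N + 1), h.symm⟩
  have h' : K + (N + 1) = n := Nat.succ.inj h
  ext a b
  have hminor : A.submatrix (Sum.elim (headIndex h) (tailIndex h ∘ b.succAbove))
        (Sum.elim (headIndex h) (tailIndex h ∘ a.succAbove)) =
      (A.submatrix (tailIndex h b).succAbove (tailIndex h a).succAbove).submatrix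
        (finSumFinEquiv.trans (finCongr h')) (finSumFinEquiv.trans (finCongr h')) := by
    rw [← succAbove_tailIndex_comp_finSumFinEquiv h h' a,
      ← succAbove_tailIndex_comp_finSumFinEquiv h h' b]
    rfl
  rw [adjugate_fin_succ_eq_det_submatrix, fractionFreeSchur, submatrix_submatrix,
    det_borderedMinors_submatrix, hminor, det_submatrix_equiv_self, Matrix.smul_apply,
    submatrix_apply, adjugate_fin_succ_eq_det_submatrix, ← leadingMinor_eq_det, Fintype.card_fin]
  have hsign : (-1 : S) ^ ((tailIndex h b : ℕ) + tailIndex h a) = (-1) ^ (b + a : ℕ) := by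
    change (-1 : S) ^ ((K + b) + (K + a) : ℕ) = _
    rw [add_add_add_comm, pow_add, Even.neg_one_pow ⟨K, rfl⟩, one_mul]
  rw [hsign, smul_eq_mul, mul_left_comm]
  rfl

end LeadingBlock

section Content

open RingTheory.Sequence
open scoped Pointwise

variable {S ι κ : Type*} [CommRing S]

theorem isWeaklyRegular_pair_iff {p q : S} :
    IsWeaklyRegular S [p, q] ↔ IsRegular p ∧ ∀ x y, q * x = p * y → p ∣ x := by
  rw [isWeaklyRegular_cons_iff, isWeaklyRegular_singleton_iff, ← isLeftRegular_iff_isRegular,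
    isLeftRegular_iff, isSMulRegular_quotient_iff_mem_of_smul_mem]
  have hmem (y : S) : y ∈ p • (⊤ : Submodule S S) ↔ ∃ x, y = p * x := by
    simp only [Submodule.mem_smul_pointwise_iff_exists, Submodule.mem_top, true_and, smul_eq_mul,
      eq_comm]
  simp only [hmem, smul_eq_mul, forall_exists_index, dvd_def]

theorem isContent_smul_of_isWeaklyRegular {g : S} (hg : IsRegular g) {C : Matrix ι κ S}
    {a a' : ι} {b b' : κ} (h : IsWeaklyRegular S [C a b, C a' b']) : IsContent g (g • C) := by
  obtain ⟨hreg, hdvd⟩ := isWeaklyRegular_pair_iff.mp h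
  refine ⟨fun _ _ => dvd_mul_right _ _, fun f hf => ?_⟩
  obtain ⟨x, hx : g * C a b = f * x⟩ := hf a b
  obtain ⟨y, hy : g * C a' b' = f * y⟩ := hf a' b'
  have hfreg : IsRegular f := (hx ▸ hg.mul hreg).of_mul_left
  obtain ⟨z, rfl⟩ := hdvd x y (hfreg.left (by linear_combination C a b * hy - C a' b' * hx))
  exact ⟨z, hreg.left (by linear_combination hx)⟩

theorem IsContent.units_smul {c : S} {C : Matrix ι κ S} (h : IsContent c C) (u : Sˣ) :
    IsContent c (u • C) := by
  simpa only [IsContent, Matrix.smul_apply, Units.smul_def, smul_eq_mul, Units.dvd_mul_left]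
    using h

theorem IsContent.mul_unit {c : S} {C : Matrix ι κ S} (h : IsContent c C) (u : Sˣ) :
    IsContent (c * u) C := by
  simpa only [IsContent, Units.mul_right_dvd, Units.dvd_mul_right] using h

theorem IsContent.isCancelled_iff {g : S} {C D : Matrix ι κ S} (hC : IsContent g (g • C))
    (hg : IsRegular g) : IsCancelled (g • C) D ↔ ∃ u : Sˣ, D = u • C := by
  constructor
  · rintro ⟨c, hc, hCD⟩
    obtain ⟨x, rfl⟩ := hc.2 g hC.1
    obtain ⟨y, hy⟩ := hC.2 _ hc.1
    have hxy : x * y = 1 := hg.left (by linear_combination -hy)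
    refine ⟨⟨y, x, by rw [mul_comm, hxy], hxy⟩, ?_⟩
    ext a b
    have hab : g * C a b = g * x * D a b := congrFun₂ hCD a b
    have hCx : C a b = x * D a b := hg.left (by linear_combination hab)
    calc D a b = y * (x * D a b) := by linear_combination -D a b * hxy
      _ = y * C a b := by rw [hCx]
  · rintro ⟨u, rfl⟩
    refine ⟨g * ↑u⁻¹, hC.mul_unit u⁻¹, ?_⟩
    rw [Units.smul_def, smul_smul, mul_assoc, Units.inv_mul, mul_one]

end Content

section ReducedDelta

open RingTheory.Sequence

variable {S : Type*} [CommRing S] {K N n : ℕ}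

theorem isReducedDelta_zero_iff {k : ℕ} {A : Matrix (Fin (2 ^ (k + 1))) (Fin (2 ^ (k + 1))) S}
    {D : Matrix (Fin (2 ^ k)) (Fin (2 ^ k)) S} :
    IsReducedDelta 0 A D ↔ IsCancelled (fractionFreeDelta A) D :=
  ⟨fun | .zero _ _ h => h, .zero A D⟩

theorem isReducedDelta_succ_iff {m k i : ℕ} {A : Matrix (Fin (2 ^ m)) (Fin (2 ^ m)) S}
    {D : Matrix (Fin (2 ^ k)) (Fin (2 ^ k)) S} :
    IsReducedDelta (i + 1) A D ↔ ∃ B : Matrix (Fin (2 ^ (k + 1))) (Fin (2 ^ (k + 1))) S,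
      IsReducedDelta i A B ∧ IsCancelled (fractionFreeDelta B) D :=
  ⟨fun | .succ _ B _ hB hD => ⟨B, hB, hD⟩, fun ⟨B, hB, hD⟩ => .succ A B D hB hD⟩

theorem adjugate_units_smul_fractionFreeSchur (h : K + N = n) (hN : 2 ≤ N)
    (A : Matrix (Fin n) (Fin n) S) (u : Sˣ) :
    (u • fractionFreeSchur h A).adjugate = leadingMinor A K ^ (N - 2) •
      u ^ (N - 1) • A.adjugate.submatrix (tailIndex h) (tailIndex h) := by
  rw [Units.smul_def, Matrix.adjugate_smul, adjugate_fractionFreeSchur h hN, Fintype.card_fin,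
    smul_comm, ← Units.val_pow_eq_pow_val, Units.smul_def]

/-- A matrix is generic enough for the recursion on the `Δ`s: its leading minors are regular, and
any two distinct diagonal entries of one of its fraction-free Schur complements form a regular
sequence, hence have no common factor. -/
structure HasRegularMinors (A : Matrix (Fin n) (Fin n) S) : Prop where
  isRegular_leadingMinor (K : ℕ) : IsRegular (leadingMinor A K)
  isWeaklyRegular_fractionFreeSchur {K N : ℕ} (h : K + N = n) {a b : Fin N} : a ≠ b →
    IsWeaklyRegular S [fractionFreeSchur h A a a, fractionFreeSchur h A b b]

namespace HasRegularMinors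

variable {A : Matrix (Fin n) (Fin n) S}

theorem isContent_smul_fractionFreeSchur (hA : HasRegularMinors A) (h : K + N = n) (hN : 2 ≤ N)
    {g : S} (hg : IsRegular g) : IsContent g (g • fractionFreeSchur h A) :=
  isContent_smul_of_isWeaklyRegular hg
    (hA.isWeaklyRegular_fractionFreeSchur h (a := ⟨0, by omega⟩) (b := ⟨1, hN⟩) (by simp))

theorem isContent_smul_adjugate_submatrix (hA : HasRegularMinors A) (h : K + N = n) (hN : 2 ≤ N)
    {g : S} (hg : IsRegular g) :
    IsContent g (g • A.adjugate.submatrix (tailIndex h) (tailIndex h)) := by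
  -- The last two diagonal entries of `Adj A` are, by the case `N = 2` of
  -- `adjugate_fractionFreeSchur`, diagonal entries of a fraction-free Schur complement.
  obtain ⟨N, rfl⟩ := Nat.exists_eq_add_of_le' hN
  have hL : K + N + 2 = n := h
  have hadj : A.adjugate.submatrix (tailIndex hL) (tailIndex hL) =
      (fractionFreeSchur hL A).adjugate := by
    rw [adjugate_fractionFreeSchur hL le_rfl, Nat.sub_self, pow_zero, one_smul]
  have hentry (s : Fin 2) :
      A.adjugate.submatrix (tailIndex h) (tailIndex h) (Fin.natAdd N s) (Fin.natAdd N s) =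
        (fractionFreeSchur hL A).adjugate s s := by
    rw [← hadj, ← tailIndex_comp_tailIndex h rfl hL]
    rfl
  apply isContent_smul_of_isWeaklyRegular hg
    (a := Fin.natAdd N 0) (b := Fin.natAdd N 0) (a' := Fin.natAdd N 1) (b' := Fin.natAdd N 1)
  rw [hentry, hentry, Matrix.adjugate_fin_two]
  exact hA.isWeaklyRegular_fractionFreeSchur hL (by decide)

theorem isCancelled_fractionFreeDelta_iff {k : ℕ} (hA : HasRegularMinors A) (hk : 1 ≤ k)
    (h : K + 2 ^ (k + 1) = n) (h' : K + 2 ^ k + 2 ^ k = n) (u : Sˣ)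
    {D : Matrix (Fin (2 ^ k)) (Fin (2 ^ k)) S} :
    IsCancelled (fractionFreeDelta (u • fractionFreeSchur h A)) D ↔
      ∃ v : Sˣ, D = v • fractionFreeSchur h' A := by
  have hdelta : fractionFreeDelta (u • fractionFreeSchur h A) =
      ((u : S) ^ (2 ^ k + 1) * leadingMinor A K ^ 2 ^ k) • fractionFreeSchur h' A := by
    rw [fractionFreeDelta_eq_fractionFreeSchur (by ring), Units.smul_def, fractionFreeSchur_smul,
      fractionFreeSchur_fractionFreeSchur h _ h', smul_smul]
  have hreg : IsRegular ((u : S) ^ (2 ^ k + 1) * leadingMinor A K ^ 2 ^ k) :=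
    (u.isRegular.pow _).mul ((hA.isRegular_leadingMinor K).pow _)
  have hN : 2 ≤ 2 ^ k := Nat.le_self_pow (by omega) 2
  rw [hdelta, (hA.isContent_smul_fractionFreeSchur h' hN hreg).isCancelled_iff hreg]

theorem isReducedDelta_iff {m k i : ℕ} {A : Matrix (Fin (2 ^ m)) (Fin (2 ^ m)) S}
    (hA : HasRegularMinors A) (h : K + 2 ^ k = 2 ^ m) (hk : 1 ≤ k) (hm : k + (i + 1) = m)
    {D : Matrix (Fin (2 ^ k)) (Fin (2 ^ k)) S} :
    IsReducedDelta i A D ↔ ∃ u : Sˣ, D = u • fractionFreeSchur h A := by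
  have hdouble (k : ℕ) : 2 ^ (k + 1) = 2 ^ k + 2 ^ k := by ring
  induction i generalizing K k with
  | zero =>
    subst hm
    obtain rfl : K = 2 ^ k := Nat.add_right_cancel (h.trans (hdouble k))
    have hcontent := hA.isContent_smul_fractionFreeSchur h (Nat.le_self_pow (by omega) 2)
      isRegular_one
    rw [isReducedDelta_zero_iff, fractionFreeDelta_eq_fractionFreeSchur h]
    simpa only [one_smul] using hcontent.isCancelled_iff isRegular_one
  | succ i ih =>
    obtain ⟨L, rfl⟩ : ∃ L, K = L + 2 ^ k := Nat.exists_eq_add_of_le' <| by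
      have : 2 ^ (k + 1) ≤ 2 ^ m := Nat.pow_le_pow_right two_pos (by omega)
      rw [hdouble] at this
      omega
    have h' : L + 2 ^ (k + 1) = 2 ^ m := by rw [hdouble, ← add_assoc, h]
    rw [isReducedDelta_succ_iff]
    constructor
    · rintro ⟨B, hB, hD⟩
      obtain ⟨u, rfl⟩ := (ih h' (by omega) (by omega)).mp hB
      exact (hA.isCancelled_fractionFreeDelta_iff hk h' h u).mp hD
    · exact fun hD => ⟨_, (ih h' (by omega) (by omega)).mpr ⟨1, rfl⟩,
        (hA.isCancelled_fractionFreeDelta_iff hk h' h 1).mpr hD⟩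

theorem isContent_adjugate_units_smul_fractionFreeSchur (hA : HasRegularMinors A) (h : K + N = n)
    (hN : 2 ≤ N) (u : Sˣ) :
    IsContent (leadingMinor A K ^ (N - 2)) (u • fractionFreeSchur h A).adjugate := by
  rw [adjugate_units_smul_fractionFreeSchur h hN, smul_comm]
  have hK := (hA.isRegular_leadingMinor K).pow (N - 2)
  exact (hA.isContent_smul_adjugate_submatrix h hN hK).units_smul _

end HasRegularMinors

end ReducedDelta

section MonomialOrders

open MvPolynomial RingTheory.Sequence
open scoped MonomialOrder

variable {σ R : Type*} [CommRing R]

theorem nonempty_monomialOrder.{u} (σ : Type u) : Nonempty (MonomialOrder.{u, u} σ) := by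
  classical
  let _ : LinearOrder σ := linearOrderOfSTO (Function.swap WellOrderingRel)
  have : WellFoundedGT σ := ⟨IsWellFounded.wf (r := WellOrderingRel)⟩
  exact ⟨MonomialOrder.lex⟩

/-- The refinement of a weight by a monomial order: exponents are compared first by their weight,
and those of equal weight by the given order. -/
noncomputable def weightedMonomialOrder (mo : MonomialOrder σ) (w : σ → ℕ) : MonomialOrder σ :=
  let φ : (σ →₀ ℕ) →+ ℕ ×ₗ mo.syn :=
    { toFun := fun d => toLex (Finsupp.weight w d, mo.toSyn d)
      map_zero' := by simp only [map_zero]; rfl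
      map_add' := fun a b => by simp only [map_add]; rfl }
  have hφ : Function.Injective φ := fun _ _ h => mo.toSyn.injective (Prod.ext_iff.mp h).2
  { syn := AddMonoidHom.mrange φ
    toSyn := (AddEquiv.ofBijective φ.mrangeRestrict
      ⟨fun _ _ h => hφ (congrArg Subtype.val h), φ.mrangeRestrict_surjective⟩ :
        (σ →₀ ℕ) ≃+ AddMonoidHom.mrange φ)
    toSyn_monotone := fun a b h => by
      have hw : Finsupp.weight w a ≤ Finsupp.weight w b := by
        obtain ⟨c, rfl⟩ := exists_add_of_le h
        exact (map_add (Finsupp.weight w) a c).symm ▸ le_self_add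
      exact Prod.Lex.toLex_mono ⟨hw, mo.toSyn_monotone h⟩ }

theorem weightedMonomialOrder_lt (mo : MonomialOrder σ) {w : σ → ℕ} {a b : σ →₀ ℕ}
    (h : Finsupp.weight w a < Finsupp.weight w b) : a ≺[weightedMonomialOrder mo w] b :=
  show toLex (_, mo.toSyn a) < toLex (_, mo.toSyn b) from Prod.Lex.toLex_lt_toLex.mpr (Or.inl h)

theorem degree_weightedMonomialOrder_eq (mo : MonomialOrder σ) {w : σ → ℕ} {p : MvPolynomial σ R}
    {d : σ →₀ ℕ} (hd : d ∈ p.support)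
    (hlt : ∀ e ∈ p.support, e ≠ d → Finsupp.weight w e < Finsupp.weight w d) :
    (weightedMonomialOrder mo w).degree p = d := by
  apply (weightedMonomialOrder mo w).toSyn.injective
  refine le_antisymm ?_ ((weightedMonomialOrder mo w).le_degree hd)
  rw [MonomialOrder.degree_le_iff]
  intro e he
  obtain rfl | hne := eq_or_ne e d
  · exact le_rfl
  · exact (weightedMonomialOrder_lt mo (hlt e he hne)).le

theorem isRegular_of_isUnit_leadingCoeff (mo : MonomialOrder σ) {p : MvPolynomial σ R}
    (hp : IsUnit (mo.leadingCoeff p)) : IsRegular p :=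
  isRegular_iff_mem_nonZeroDivisors.mpr <|
    MonomialOrder.mem_nonZeroDivisors_of_leadingCoeff_mem_nonZeroDivisors hp.mem_nonZeroDivisors

theorem isWeaklyRegular_pair_of_disjoint_degree (mo : MonomialOrder σ) {p q : MvPolynomial σ R}
    (hp : IsUnit (mo.leadingCoeff p)) (hq : IsRegular (mo.leadingCoeff q))
    (hpq : Disjoint (mo.degree p) (mo.degree q)) :
    IsWeaklyRegular (MvPolynomial σ R) [p, q] := by
  rw [isWeaklyRegular_pair_iff]
  refine ⟨isRegular_of_isUnit_leadingCoeff mo hp, fun x y h => ?_⟩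
  -- If the remainder `r` of `x` by `p` were nonzero, its leading monomial would be divisible by
  -- that of `p`, because `q * r` is a multiple of `p`.
  obtain ⟨s, r, rfl, -, hr⟩ := mo.div_single hp x
  suffices r = 0 by rw [this, add_zero]; exact dvd_mul_left p s
  by_contra hr0
  have hqr : q * r = p * (y - q * s) := by linear_combination h
  have hqr0 : q * r ≠ 0 := by
    rw [← mo.leadingCoeff_ne_zero_iff, mo.leadingCoeff_mul_of_isRegular_left hq]
    exact hq.left.mul_left_eq_zero_iff.not.mpr (mo.leadingCoeff_ne_zero_iff.mpr hr0)
  have hdeg := mo.degree_mul_of_isRegular_left hp.isRegular (right_ne_zero_of_mul (hqr ▸ hqr0))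
  rw [← hqr, mo.degree_mul_of_isRegular_left hq hr0] at hdeg
  refine hr _ (mo.degree_mem_support hr0) fun v => ?_
  have hmin : min (mo.degree p v) (mo.degree q v) = 0 := DFunLike.congr_fun hpq.eq_bot v
  have hv := DFunLike.congr_fun hdeg v
  simp only [Finsupp.add_apply] at hv
  omega

end MonomialOrders

section GenericMinors

open Matrix MvPolynomial RingTheory.Sequence

theorem perm_eq_of_forall_le {ι : Type*} [PartialOrder ι] [WellFoundedLT ι] {σ τ : Equiv.Perm ι}
    (h : ∀ i, σ i ≤ τ i) : σ = τ := by
  suffices ∀ j, σ (τ.symm j) = j from Equiv.ext fun i => by simpa using this (τ i)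
  intro j
  induction j using WellFoundedLT.induction with
  | ind j ih =>
    have hle : σ (τ.symm j) ≤ j := by simpa using h (τ.symm j)
    by_contra hne
    exact hne (τ.symm.injective (σ.injective (ih _ (lt_of_le_of_ne hle hne))))

variable {R ι μ ν : Type*} [CommRing R] [Fintype ι]

/-- The exponent of the monomial `∏ i, X (f i, g (τ i))`, which is, up to its sign, the term of the
permutation `τ` in the expansion of the minor of a generic matrix on the rows `f` and the
columns `g`. -/
noncomputable def permExponent (f : ι → μ) (g : ι → ν) (τ : Equiv.Perm ι) : μ × ν →₀ ℕ :=
  ∑ i, Finsupp.single (f i, g (τ i)) 1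

theorem support_permExponent (f : ι → μ) (g : ι → ν) (τ : Equiv.Perm ι) :
    ((permExponent f g τ).support : Set (μ × ν)) = Set.range fun i => (f i, g (τ i)) := by
  ext v
  simp [permExponent, Finsupp.single_apply_eq_zero, eq_comm (a := v)]

theorem degree_permExponent (f : ι → μ) (g : ι → ν) (τ : Equiv.Perm ι) :
    (permExponent f g τ).degree = Fintype.card ι := by
  simp [permExponent]

/-- A permutation is the leading one for a minor and a set of positions if it is the only one all
of whose positions lie in that set. -/
def IsLeadingPerm (V : Set (μ × ν)) (f : ι → μ) (g : ι → ν) (τ : Equiv.Perm ι) : Prop :=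
  ∀ σ : Equiv.Perm ι, (∀ i, (f i, g (σ i)) ∈ V) ↔ σ = τ

theorem IsLeadingPerm.weight_permExponent_lt {V : Set (μ × ν)} {f : ι → μ} {g : ι → ν}
    {τ σ : Equiv.Perm ι} (hτ : IsLeadingPerm V f g τ) (hσ : σ ≠ τ) :
    Finsupp.weight (V.indicator (1 : μ × ν → ℕ)) (permExponent f g σ) <
      Finsupp.weight (V.indicator (1 : μ × ν → ℕ)) (permExponent f g τ) := by
  have hweight (ρ : Equiv.Perm ι) : Finsupp.weight (V.indicator (1 : μ × ν → ℕ))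
      (permExponent f g ρ) = ∑ i, V.indicator (1 : μ × ν → ℕ) (f i, g (ρ i)) := by
    simp [permExponent, Finsupp.weight_single]
  have hmem := (hτ τ).mpr rfl
  obtain ⟨i, hi⟩ := not_forall.mp (mt (hτ σ).mp hσ)
  rw [hweight, hweight]
  refine Finset.sum_lt_sum (fun j _ => ?_) ⟨i, Finset.mem_univ i, ?_⟩
  · rw [Set.indicator_of_mem (hmem j)]
    exact Set.indicator_le_self' (fun _ _ => zero_le) _
  · rw [Set.indicator_of_mem (hmem i), Set.indicator_of_notMem hi]
    exact one_pos

variable [DecidableEq ι]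

theorem det_submatrix_mvPolynomialX (f : ι → μ) (g : ι → ν) :
    ((mvPolynomialX μ ν R).submatrix f g).det =
      ∑ τ : Equiv.Perm ι, monomial (permExponent f g τ) ((Equiv.Perm.sign τ : ℤ) : R) := by
  rw [← det_transpose, det_apply']
  refine Finset.sum_congr rfl fun τ _ => ?_
  rw [permExponent, ← mul_one ((Equiv.Perm.sign τ : ℤ) : R), ← C_mul_monomial, monomial_sum_one]
  simp only [transpose_apply, submatrix_apply, mvPolynomialX_apply, map_intCast, X]

theorem isHomogeneous_det_submatrix_mvPolynomialX (f : ι → μ) (g : ι → ν) :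
    ((mvPolynomialX μ ν R).submatrix f g).det.IsHomogeneous (Fintype.card ι) := by
  rw [det_submatrix_mvPolynomialX]
  exact .sum _ _ _ fun τ _ => isHomogeneous_monomial _ (degree_permExponent f g τ)

namespace IsLeadingPerm

variable {V : Set (μ × ν)} {f : ι → μ} {g : ι → ν} {τ : Equiv.Perm ι}

theorem coeff_det (hτ : IsLeadingPerm V f g τ) :
    coeff (permExponent f g τ) ((mvPolynomialX μ ν R).submatrix f g).det =
      ((Equiv.Perm.sign τ : ℤ) : R) := by
  classical
  rw [det_submatrix_mvPolynomialX, coeff_sum, Finset.sum_eq_single τ, coeff_monomial, if_pos rfl]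
  · intro σ _ hσ
    rw [coeff_monomial, if_neg fun h => (hτ.weight_permExponent_lt hσ).ne (by rw [h])]
  · exact fun h => absurd (Finset.mem_univ τ) h

theorem degree_det [Nontrivial R] (hτ : IsLeadingPerm V f g τ) (mo : MonomialOrder (μ × ν)) :
    (weightedMonomialOrder mo (V.indicator 1)).degree
      ((mvPolynomialX μ ν R).submatrix f g).det = permExponent f g τ := by
  apply degree_weightedMonomialOrder_eq
  · rw [mem_support_iff, hτ.coeff_det]
    exact ((Equiv.Perm.sign τ).isUnit.map (Int.castRingHom R)).ne_zero
  · intro e he hne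
    classical
    rw [det_submatrix_mvPolynomialX] at he
    obtain ⟨σ, -, hσ⟩ := Finset.mem_biUnion.mp (support_sum he)
    obtain rfl := Finset.mem_singleton.mp (support_monomial_subset hσ)
    exact hτ.weight_permExponent_lt fun h => hne (by rw [h])

theorem isUnit_leadingCoeff_det [Nontrivial R] (hτ : IsLeadingPerm V f g τ)
    (mo : MonomialOrder (μ × ν)) : IsUnit ((weightedMonomialOrder mo (V.indicator 1)).leadingCoeff
      ((mvPolynomialX μ ν R).submatrix f g).det) := by
  rw [MonomialOrder.leadingCoeff, hτ.degree_det, hτ.coeff_det]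
  exact (Equiv.Perm.sign τ).isUnit.map (Int.castRingHom R)

end IsLeadingPerm

theorem isRegular_det_submatrix_mvPolynomialX [Nontrivial R] {f : ι → μ} {g : ι → ν}
    (hf : f.Injective) (hg : g.Injective) :
    IsRegular ((mvPolynomialX μ ν R).submatrix f g).det := by
  obtain ⟨mo⟩ := nonempty_monomialOrder (μ × ν)
  have hone : IsLeadingPerm (Set.range fun i => (f i, g i)) f g 1 := by
    intro σ
    simp only [Set.mem_range, Prod.mk.injEq, hf.eq_iff, hg.eq_iff, exists_eq_left, Equiv.ext_iff,
      Equiv.Perm.one_apply]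
    exact forall_congr' fun i => eq_comm
  exact isRegular_of_isUnit_leadingCoeff _ (hone.isUnit_leadingCoeff_det mo)

theorem isWeaklyRegular_det_submatrix_mvPolynomialX [Nontrivial R] {K : ℕ}
    {f g : Fin (K + 1) → μ} {f' g' : Fin (K + 1) → ν} (hf : f.Injective) (hf' : f'.Injective)
    (hg : g.Injective) (hg' : g'.Injective) (hfg : ∀ i j, f i = g j → i = j ∧ i ≠ Fin.last K)
    (hfg' : ∀ i j, f' i = g' j → i = j) :
    IsWeaklyRegular (MvPolynomial (μ × ν) R)
      [((mvPolynomialX μ ν R).submatrix f f').det, ((mvPolynomialX μ ν R).submatrix g g').det] := by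
  obtain ⟨mo⟩ := nonempty_monomialOrder (μ × ν)
  -- The leading permutations are the cycle for the first minor and the identity for the second.
  let V : Set (μ × ν) := Set.range (fun i => (f i, f' (finRotate _ i))) ∪
    Set.range fun i => (g i, g' i)
  have hcycle : IsLeadingPerm V f f' (finRotate (K + 1)) := by
    refine fun σ => ⟨fun h => perm_eq_of_forall_le fun i => ?_, ?_⟩
    · obtain ⟨j, hj⟩ | ⟨j, hj⟩ := h i <;> obtain ⟨hrow, hcol⟩ := Prod.mk.inj hj
      · rw [← hf' hcol, hf hrow]
      · obtain ⟨rfl, hlast⟩ := hfg _ _ hrow.symm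
        rw [hfg' _ _ hcol.symm]
        exact ((lt_finRotate_iff_ne_last _).mpr hlast).le
    · rintro rfl i
      exact Or.inl ⟨i, rfl⟩
  have hdiag : IsLeadingPerm V g g' 1 := by
    refine fun σ => ⟨fun h => (perm_eq_of_forall_le fun i => ?_).symm, ?_⟩
    · obtain ⟨j, hj⟩ | ⟨j, hj⟩ := h i <;> obtain ⟨hrow, hcol⟩ := Prod.mk.inj hj
      · obtain ⟨rfl, hlast⟩ := hfg _ _ hrow
        rw [← hfg' _ _ hcol]
        exact ((lt_finRotate_iff_ne_last _).mpr hlast).le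
      · rw [← hg' hcol, hg hrow, Equiv.Perm.one_apply]
    · rintro rfl i
      exact Or.inr ⟨i, rfl⟩
  refine isWeaklyRegular_pair_of_disjoint_degree _ (hcycle.isUnit_leadingCoeff_det mo)
    (hdiag.isUnit_leadingCoeff_det mo).isRegular ?_
  rw [hcycle.degree_det, hdiag.degree_det, Finsupp.disjoint_iff, ← Finset.disjoint_coe,
    support_permExponent, support_permExponent, Set.disjoint_range_iff]
  intro i j hij
  obtain ⟨hrow, hcol⟩ := Prod.mk.inj hij
  obtain ⟨rfl, hlast⟩ := hfg _ _ hrow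
  exact ((lt_finRotate_iff_ne_last _).mpr hlast).ne' (hfg' _ _ hcol)

end GenericMinors

section GenericMatrix

open Matrix MvPolynomial RingTheory.Sequence

variable {R : Type*} [CommRing R] {n : ℕ}

theorem isHomogeneous_adjugate_mvPolynomialX (a b : Fin n) :
    ((mvPolynomialX (Fin n) (Fin n) R).adjugate a b).IsHomogeneous (n - 1) := by
  obtain ⟨n, rfl⟩ : ∃ n', n = n' + 1 := Nat.exists_eq_succ_of_ne_zero a.pos.ne'
  have hsign : (-1 : MvPolynomial (Fin (n + 1) × Fin (n + 1)) R) ^ (b + a : ℕ) =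
      C ((-1) ^ (b + a : ℕ)) := by
    simp only [map_pow, map_neg, map_one]
  rw [adjugate_fin_succ_eq_det_submatrix, hsign]
  simpa only [Fintype.card_fin, Nat.add_sub_cancel] using
    (isHomogeneous_det_submatrix_mvPolynomialX b.succAbove a.succAbove).C_mul _

theorem adjugate_mvPolynomialX_ne_zero [Nontrivial R] (a b : Fin n) :
    (mvPolynomialX (Fin n) (Fin n) R).adjugate a b ≠ 0 := by
  obtain ⟨n, rfl⟩ : ∃ n', n = n' + 1 := Nat.exists_eq_succ_of_ne_zero a.pos.ne'
  rw [adjugate_fin_succ_eq_det_submatrix]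
  exact ((isUnit_one.neg.pow _).isRegular.mul (isRegular_det_submatrix_mvPolynomialX
    Fin.succAbove_right_injective Fin.succAbove_right_injective)).ne_zero

/-- The first `K` of `n = K + N` indices, followed by the `a`-th of the last `N` ones. -/
def borderIndex {K N : ℕ} (h : K + N = n) (a : Fin N) : Fin (K + 1) → Fin n :=
  Fin.snoc (headIndex h) (tailIndex h a)

theorem borderIndex_eq_borderIndex_iff {K N : ℕ} (h : K + N = n) {a b : Fin N}
    {i j : Fin (K + 1)} :
    borderIndex h a i = borderIndex h b j ↔ i = j ∧ (i = Fin.last K → a = b) := by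
  have hval (a : Fin N) (i : Fin (K + 1)) :
      (borderIndex h a i : ℕ) = if i = Fin.last K then K + a else i := by
    cases i using Fin.lastCases <;> simp [borderIndex, headIndex, tailIndex]
  simp only [Fin.ext_iff, hval, Fin.val_last]
  split_ifs <;> omega

theorem borderIndex_injective {K N : ℕ} (h : K + N = n) (a : Fin N) :
    (borderIndex h a).Injective :=
  fun _ _ hij => ((borderIndex_eq_borderIndex_iff h).mp hij).1

theorem fractionFreeSchur_eq_det {K N : ℕ} (h : K + N = n) (A : Matrix (Fin n) (Fin n) R)
    (a b : Fin N) :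
    fractionFreeSchur h A a b = (A.submatrix (borderIndex h a) (borderIndex h b)).det := by
  let e : Fin K ⊕ Unit ≃ Fin (K + 1) :=
    ((Equiv.refl _).sumCongr finOneEquiv.symm).trans finSumFinEquiv
  have he (c : Fin N) : borderIndex h c ∘ e = Sum.elim (headIndex h) fun _ => tailIndex h c := by
    funext s
    cases s with
    | inl s => exact Fin.snoc_castSucc (α := fun _ => Fin n) ..
    | inr => exact Fin.snoc_last (α := fun _ => Fin n) ..
  rw [← det_submatrix_equiv_self e, submatrix_submatrix, he, he]
  rfl

theorem hasRegularMinors_mvPolynomialX [Nontrivial R] :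
    HasRegularMinors (mvPolynomialX (Fin n) (Fin n) R) where
  isRegular_leadingMinor _ :=
    isRegular_det_submatrix_mvPolynomialX Subtype.val_injective Subtype.val_injective
  isWeaklyRegular_fractionFreeSchur {K N} h a b hab := by
    have hborder (i j : Fin (K + 1)) (hij : borderIndex h a i = borderIndex h b j) :
        i = j ∧ i ≠ Fin.last K :=
      ((borderIndex_eq_borderIndex_iff h).mp hij).imp_right (mt · hab)
    rw [fractionFreeSchur_eq_det, fractionFreeSchur_eq_det]
    exact isWeaklyRegular_det_submatrix_mvPolynomialX (borderIndex_injective h a)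
      (borderIndex_injective h a) (borderIndex_injective h b) (borderIndex_injective h b) hborder
      fun i j hij => (hborder i j hij).1

end GenericMatrix

section Degrees

open Matrix MvPolynomial

variable {R σ : Type*} [CommRing R] {p : MvPolynomial σ R} {e : ℕ}

theorem totalDegree_aeval_le_of_isHomogeneous {τ S : Type*} [CommRing S] [Algebra R S]
    (hp : p.IsHomogeneous e) {f : σ → MvPolynomial τ S} {d : ℕ}
    (hf : ∀ v, (f v).totalDegree ≤ d) : (aeval (R := R) f p).totalDegree ≤ e * d := by
  rw [aeval_def, eval₂_eq]
  refine totalDegree_finsetSum_le fun c hc => ?_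
  calc (algebraMap R (MvPolynomial τ S) (p.coeff c) * ∏ v ∈ c.support, f v ^ c v).totalDegree
      ≤ (∏ v ∈ c.support, f v ^ c v).totalDegree := by
        refine (totalDegree_mul _ _).trans_eq ?_
        rw [MvPolynomial.algebraMap_apply, totalDegree_C, zero_add]
    _ ≤ ∑ v ∈ c.support, c v * d :=
        (totalDegree_finsetProd _ _).trans <| Finset.sum_le_sum fun v _ =>
          (totalDegree_pow _ _).trans (Nat.mul_le_mul_left _ (hf v))
    _ = e * d := by rw [← Finset.sum_mul, hp.degree_eq_sum_deg_support hc]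

theorem totalDegree_genericPolynomialMatrix_le (n r d : ℕ) (s t : Fin n) :
    (genericPolynomialMatrix R n r d s t).totalDegree ≤ d := by
  rw [genericPolynomialMatrix, Matrix.of_apply]
  refine totalDegree_finsetSum_le fun e he => totalDegree_finsetSum_le fun α hα => ?_
  refine (totalDegree_monomial_le _ _).trans ?_
  rw [Finsupp.sum_fintype _ _ fun _ => rfl]
  exact (Finset.mem_finsuppAntidiag.mp hα).1.le.trans (Finset.mem_range_succ_iff.mp he)

/-- The specialization of the coefficients of the general polynomials of degree `d` that leaves
only the `d`-th powers of the `v`-th variable: it turns the entry `(s, t)` of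
`genericPolynomialMatrix R n r d` into the monomial with coefficient `X (s, t)` and exponent
`d` at `v`. -/
noncomputable def purePowerSpecialization (R : Type*) [CommRing R] (n d : ℕ) {r : ℕ} (v : Fin r) :
    MvPolynomial (Fin n × Fin n × (Fin r →₀ ℕ)) R →ₐ[R] MvPolynomial (Fin n × Fin n) R :=
  aeval fun u => if u.2.2 = Finsupp.single v d then X (u.1, u.2.1) else 0

theorem mapAlgHom_genericPolynomialMatrix (n d : ℕ) {r : ℕ} (v : Fin r) (s t : Fin n) :
    mapAlgHom (purePowerSpecialization R n d v) (genericPolynomialMatrix R n r d s t) =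
      monomial (Finsupp.single v d) (X (s, t)) := by
  have hmap (α : Fin r →₀ ℕ) : mapAlgHom (purePowerSpecialization R n d v)
      (monomial α (X (s, t, α))) =
        if α = Finsupp.single v d then monomial (Finsupp.single v d) (X (s, t)) else 0 := by
    split_ifs with h <;> simp [purePowerSpecialization, map_monomial, h]
  simp only [genericPolynomialMatrix, Matrix.of_apply, map_sum, hmap, Finset.sum_ite_eq',
    Finset.mem_finsuppAntidiag]
  simp

theorem aeval_monomial_of_isHomogeneous {τ : Type*} (hp : p.IsHomogeneous e) (μ : τ →₀ ℕ) :
    aeval (R := R) (fun v => monomial μ (X v : MvPolynomial σ R)) p = monomial (e • μ) p := by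
  rw [aeval_def, eval₂_eq]
  conv_rhs => rw [p.as_sum, map_sum]
  refine Finset.sum_congr rfl fun c hc => ?_
  simp only [monomial_pow]
  rw [← monomial_sum_prod, ← Finset.sum_smul, ← hp.degree_eq_sum_deg_support hc,
    monomial_eq (s := c), MvPolynomial.algebraMap_apply, C_mul_monomial]
  rfl

theorem totalDegree_map_le {S T : Type*} [CommSemiring S] [CommSemiring T]
    (φ : S →+* T) (q : MvPolynomial σ S) : (map φ q).totalDegree ≤ q.totalDegree :=
  Finset.sup_mono (support_map_subset φ q)

theorem totalDegree_aeval_genericPolynomialMatrix {n : ℕ} {p : MvPolynomial (Fin n × Fin n) R}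
    (hp : p.IsHomogeneous e) (hp0 : p ≠ 0) {r : ℕ} (hr : 0 < r) (d : ℕ) :
    (aeval (R := R) (fun st => genericPolynomialMatrix R n r d st.1 st.2) p).totalDegree =
      e * d := by
  let v : Fin r := ⟨0, hr⟩
  have hmap : mapAlgHom (purePowerSpecialization R n d v)
      (aeval (R := R) (fun st => genericPolynomialMatrix R n r d st.1 st.2) p) =
        monomial (e • Finsupp.single v d) p := by
    simp only [comp_aeval_apply, mapAlgHom_genericPolynomialMatrix,
      aeval_monomial_of_isHomogeneous hp]
  refine le_antisymm (totalDegree_aeval_le_of_isHomogeneous hp fun st =>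
    totalDegree_genericPolynomialMatrix_le n r d st.1 st.2) ?_
  calc e * d = (monomial (e • Finsupp.single v d) p).totalDegree := by
        rw [totalDegree_monomial _ hp0, Finsupp.smul_single, Finsupp.sum_single_index rfl,
          smul_eq_mul]
    _ ≤ _ := hmap ▸ totalDegree_map_le _ _

end Degrees

section Main

theorem pred_mul_div_add_div {d n : ℕ} (h : d ∣ n) : (d - 1) * n / d + n / d = n := by
  obtain ⟨c, rfl⟩ := h
  obtain rfl | hd := d.eq_zero_or_pos
  · simp
  · rw [mul_left_comm, Nat.mul_div_cancel_left _ hd, Nat.mul_div_cancel_left _ hd,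
      Nat.sub_one_mul, Nat.sub_add_cancel (Nat.le_mul_of_pos_left c hd)]

open Matrix MvPolynomial

theorem isHomogeneous_units_smul {R σ : Type*} [CommRing R] [IsReduced R] {e : ℕ}
    {p : MvPolynomial σ R} (hp : p.IsHomogeneous e) (u : (MvPolynomial σ R)ˣ) :
    (u • p).IsHomogeneous e := by
  obtain ⟨c, -, hc⟩ := isUnit_iff_eq_C_of_isReduced.mp u.isUnit
  rw [Units.smul_def, hc, smul_eq_mul]
  exact hp.C_mul c

theorem map_adjugate_eq_smul {R S F ι : Type*} [CommRing R] [CommRing S] [FunLike F R S]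
    [RingHomClass F R S] [Fintype ι] [DecidableEq ι] (φ : F) {D Q : Matrix ι ι R} {c : R}
    (h : D.adjugate = c • Q) : (D.map φ).adjugate = φ c • Q.map φ := by
  calc (D.map φ).adjugate = D.adjugate.map φ := ((φ : R →+* S).map_adjugate D).symm
    _ = φ c • Q.map φ := by rw [h]; exact Matrix.map_smul' φ c Q (map_mul φ)

theorem aeval_leadingMinor_mvPolynomialX {R S : Type*} [CommRing R] [CommRing S] [Algebra R S]
    {n : ℕ} (A : Matrix (Fin n) (Fin n) S) (K : ℕ) :
    aeval (R := R) (fun st => A st.1 st.2) (leadingMinor (mvPolynomialX _ _ R) K) =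
      leadingMinor A K := by
  conv_rhs => rw [← mvPolynomialX_mapMatrix_aeval R A]
  exact map_leadingMinor (aeval (R := R) fun st : Fin n × Fin n => A st.1 st.2).toRingHom _ K

theorem mainTheorem3_general {R : Type*} [CommRing R] [IsReduced R] [Nontrivial R] (m i : ℕ)
    (hi : i + 2 ≤ m) :
    (∃ D : Matrix (Fin (2 ^ (m - (i + 1)))) (Fin (2 ^ (m - (i + 1))))
        (MvPolynomial (Fin (2 ^ m) × Fin (2 ^ m)) R),
      IsReducedDelta i (Matrix.mvPolynomialX (Fin (2 ^ m)) (Fin (2 ^ m)) R) D) ∧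
    ∀ D : Matrix (Fin (2 ^ (m - (i + 1)))) (Fin (2 ^ (m - (i + 1))))
        (MvPolynomial (Fin (2 ^ m) × Fin (2 ^ m)) R),
      IsReducedDelta i (Matrix.mvPolynomialX (Fin (2 ^ m)) (Fin (2 ^ m)) R) D →
      IsContent
        (leadingMinor (Matrix.mvPolynomialX (Fin (2 ^ m)) (Fin (2 ^ m)) R)
          ((2 ^ (i + 1) - 1) * 2 ^ m / 2 ^ (i + 1)) ^ (2 ^ m / 2 ^ (i + 1) - 2))
        D.adjugate ∧
      ∃ Q : Matrix (Fin (2 ^ (m - (i + 1)))) (Fin (2 ^ (m - (i + 1))))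
          (MvPolynomial (Fin (2 ^ m) × Fin (2 ^ m)) R),
        D.adjugate =
          (leadingMinor (Matrix.mvPolynomialX (Fin (2 ^ m)) (Fin (2 ^ m)) R)
            ((2 ^ (i + 1) - 1) * 2 ^ m / 2 ^ (i + 1)) ^ (2 ^ m / 2 ^ (i + 1) - 2)) • Q ∧
        (∀ a b, (Q a b).totalDegree = 2 ^ m - 1) ∧
        (∀ (S : Type*) [CommRing S] [Algebra R S] (r d : ℕ)
          (A : Matrix (Fin (2 ^ m)) (Fin (2 ^ m)) (MvPolynomial (Fin r) S)),
          (∀ s t, (A s t).totalDegree ≤ d) →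
          (D.map (MvPolynomial.aeval (R := R) fun st => A st.1 st.2)).adjugate =
            (leadingMinor A ((2 ^ (i + 1) - 1) * 2 ^ m / 2 ^ (i + 1)) ^
              (2 ^ m / 2 ^ (i + 1) - 2)) •
              Q.map (MvPolynomial.aeval (R := R) fun st => A st.1 st.2) ∧
          ∀ a b, (MvPolynomial.aeval (R := R) (fun st => A st.1 st.2) (Q a b)).totalDegree
            ≤ (2 ^ m - 1) * d) ∧
        (∀ r d : ℕ, 0 < r → ∀ a b,
          (MvPolynomial.aeval (R := R)
            (fun st => genericPolynomialMatrix R (2 ^ m) r d st.1 st.2) (Q a b)).totalDegree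
            = (2 ^ m - 1) * d) := by
  have hdvd : 2 ^ (i + 1) ∣ 2 ^ m := pow_dvd_pow 2 (by omega)
  have hNdiv : 2 ^ m / 2 ^ (i + 1) = 2 ^ (m - (i + 1)) := Nat.pow_div (by omega) two_pos
  have hsplit := pred_mul_div_add_div hdvd
  rw [hNdiv] at hsplit ⊢
  have hN : 2 ≤ 2 ^ (m - (i + 1)) := Nat.le_self_pow (by omega) 2
  have hX := hasRegularMinors_mvPolynomialX (R := R) (n := 2 ^ m)
  have hDelta (D) := hX.isReducedDelta_iff (i := i) (D := D) hsplit (by omega) (by omega)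
  refine ⟨⟨_, (hDelta _).mpr ⟨1, rfl⟩⟩, fun D hD => ?_⟩
  obtain ⟨u, rfl⟩ := (hDelta D).mp hD
  let v := u ^ (2 ^ (m - (i + 1)) - 1)
  let Q := v • (mvPolynomialX _ _ R).adjugate.submatrix (tailIndex hsplit) (tailIndex hsplit)
  have hadj := adjugate_units_smul_fractionFreeSchur hsplit hN (mvPolynomialX _ _ R) u
  have hQ (a b) : (Q a b).IsHomogeneous (2 ^ m - 1) :=
    isHomogeneous_units_smul (isHomogeneous_adjugate_mvPolynomialX _ _) v
  have hQ_ne (a b) : Q a b ≠ 0 :=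
    (smul_ne_zero_iff_ne v).mpr (adjugate_mvPolynomialX_ne_zero _ _)
  refine ⟨hX.isContent_adjugate_units_smul_fractionFreeSchur hsplit hN u, Q, hadj,
    fun a b => (hQ a b).totalDegree (hQ_ne a b), fun S _ _ r d A hA => ⟨?_, fun a b =>
    totalDegree_aeval_le_of_isHomogeneous (hQ a b) fun st => hA st.1 st.2⟩, fun r d hr a b =>
    totalDegree_aeval_genericPolynomialMatrix (hQ a b) (hQ_ne a b) hr d⟩
  rw [← aeval_leadingMinor_mvPolynomialX (R := R) A, ← map_pow]
  exact map_adjugate_eq_smul _ hadj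

end Main

theorem mainTheorem3 {R : Type*} [CommRing R] [IsDomain R] (m i : ℕ) (hi : i + 3 ≤ m) :
    (∃ D : Matrix (Fin (2 ^ (m - (i + 1)))) (Fin (2 ^ (m - (i + 1))))
        (MvPolynomial (Fin (2 ^ m) × Fin (2 ^ m)) R),
      IsReducedDelta i (Matrix.mvPolynomialX (Fin (2 ^ m)) (Fin (2 ^ m)) R) D) ∧
    ∀ D : Matrix (Fin (2 ^ (m - (i + 1)))) (Fin (2 ^ (m - (i + 1))))
        (MvPolynomial (Fin (2 ^ m) × Fin (2 ^ m)) R),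
      IsReducedDelta i (Matrix.mvPolynomialX (Fin (2 ^ m)) (Fin (2 ^ m)) R) D →
      IsContent
        (leadingMinor (Matrix.mvPolynomialX (Fin (2 ^ m)) (Fin (2 ^ m)) R)
          ((2 ^ (i + 1) - 1) * 2 ^ m / 2 ^ (i + 1)) ^ (2 ^ m / 2 ^ (i + 1) - 2))
        D.adjugate ∧
      ∃ Q : Matrix (Fin (2 ^ (m - (i + 1)))) (Fin (2 ^ (m - (i + 1))))
          (MvPolynomial (Fin (2 ^ m) × Fin (2 ^ m)) R),
        D.adjugate =
          (leadingMinor (Matrix.mvPolynomialX (Fin (2 ^ m)) (Fin (2 ^ m)) R)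
            ((2 ^ (i + 1) - 1) * 2 ^ m / 2 ^ (i + 1)) ^ (2 ^ m / 2 ^ (i + 1) - 2)) • Q ∧
        (∀ a b, (Q a b).totalDegree = 2 ^ m - 1) ∧
        (∀ (S : Type*) [CommRing S] [Algebra R S] (r d : ℕ)
          (A : Matrix (Fin (2 ^ m)) (Fin (2 ^ m)) (MvPolynomial (Fin r) S)),
          (∀ s t, (A s t).totalDegree ≤ d) →
          (D.map (MvPolynomial.aeval (R := R) fun st => A st.1 st.2)).adjugate =
            (leadingMinor A ((2 ^ (i + 1) - 1) * 2 ^ m / 2 ^ (i + 1)) ^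
              (2 ^ m / 2 ^ (i + 1) - 2)) •
              Q.map (MvPolynomial.aeval (R := R) fun st => A st.1 st.2) ∧
          ∀ a b, (MvPolynomial.aeval (R := R) (fun st => A st.1 st.2) (Q a b)).totalDegree
            ≤ (2 ^ m - 1) * d) ∧
        (∀ r d : ℕ, 0 < r → ∀ a b,
          (MvPolynomial.aeval (R := R)
            (fun st => genericPolynomialMatrix R (2 ^ m) r d st.1 st.2) (Q a b)).totalDegree
            = (2 ^ m - 1) * d) :=
  mainTheorem3_general m i (by omega)
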